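/- Let $(X,\mathsf d)$ be a complete separable metric space, let $\mathcal M(X)$, $\mathcal M(X\times X)$ be the sets of finite nonnegative Borel measures on $X$ and $X\times X$ (such measures are automatically Radon), and let $c:X\times X\to(-\infty,+\infty]$ be lower semicontinuous and bounded from below. Let $F(s)=s\log s-s+1$ for $s\ge 0$ (with $0\log 0=0$, so $F(0)=1$) be the Kullback–Leibler entropy function, with recession constant $F'_\infty=\lim_{s\to\infty}F(s)/s=+\infty$. For finite measures $\gamma,\mu$ on the same space with Lebesgue decomposition $\gamma=\sigma\mu+\gamma^\perp$, put $$\mathcal F(\gamma\mid\mu)=\int F(\sigma)\,d\mu+F'_\infty\,\gamma^\perp(\text{whole space})\in[0,+\infty],\qquad \infty\cdot 0=0 .$$ Let $F^*(\phi)=\sup_{s\ge 0}\,(s\phi-F(s))$ be the Legendre dual of $F$, with the convention $F^*(-\infty)=-F(0)$ (explicitly, $F^*(\phi)=e^{\phi}-1$ and $F^*(-\infty)=-1$). Let $\mu_0,\mu_1\in\mathcal M(X)$, $\nu_X\in\mathcal M(X\times X)$ and $\varepsilon>0$, write $\gamma_0,\gamma_1$ for the marginals of $\gamma\in\mathcal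 M(X\times X)$, and define $$\mathrm{UOT}_{X,\varepsilon}(\mu_0,\mu_1)=\inf_{\gamma\in\mathcal M(X\times X)}\Big\{\mathcal F(\gamma_0\mid\mu_0)+\mathcal F(\gamma_1\mid\mu_1)+\int_{X\times X}c\,d\gamma+\varepsilon\,\mathcal F(\gamma\mid\nu_X)\Big\}.$$ Then $$\mathrm{UOT}_{X,\varepsilon}(\mu_0,\mu_1)=\sup_{(\phi_0,\phi_1)\in\tilde\Phi}\Big\{\sum_{i=0,1}\int_X-F^*(-\phi_i)\,d\mu_i+\varepsilon\int_{X\times X}-F^*\Big(\frac{\phi_0(x_0)+\phi_1(x_1)-c(x_0,x_1)}{\varepsilon}\Big)d\nu_X(x_0,x_1)\Big\},$$ where $\tilde\Phi=\{(\phi_0,\phi_1)\in C_b(X)\times C_b(X) : -F^*(-\phi_i)\in C_b(X),\ i=0,1\}$. -/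

import Mathlib

open MeasureTheory Filter Topology
open scoped NNReal ENNReal BoundedContinuousFunction

noncomputable section

namespace UOT

/-- The integral `∫ g dμ = ∫ g⁺ dμ - ∫ g⁻ dμ` of an extended-real-valued function. It is only used
where `∫ g⁻ dμ` is finite. -/
def eintegral {α : Type*} [MeasurableSpace α] (μ : Measure α) (g : α → EReal) : EReal :=
  ((∫⁻ x, (g x).toENNReal ∂μ : ℝ≥0∞) : EReal) - ((∫⁻ x, (-g x).toENNReal ∂μ : ℝ≥0∞) : EReal)

/-- The recession constant `F'_∞ = lim_{s → ∞} F(s) / s` of an entropy function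
(the limit exists for convex `F`). -/
def recession (F : ℝ≥0 → ℝ≥0∞) : ℝ≥0∞ :=
  limsup (fun s : ℝ≥0 => F s / (s : ℝ≥0∞)) atTop

/-- The relative entropy functional `𝓕(γ ∣ μ) = ∫ F(σ) dμ + F'_∞ γ^⊥(univ)`, where
`γ = σ μ + γ^⊥` is the Lebesgue decomposition of `γ` with respect to `μ`. -/
def entropyFunctional {α : Type*} [MeasurableSpace α] (F : ℝ≥0 → ℝ≥0∞) (γ μ : Measure α) :
    ℝ≥0∞ :=
  (∫⁻ x, F (γ.rnDeriv μ x).toNNReal ∂μ) + recession F * γ.singularPart μ Set.univ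

/-- The Legendre dual `F^*(φ) = sup_{s ≥ 0} (s φ - F(s))` of a scalar function on `[0, ∞)`.
It is evaluated at extended reals, with the convention `0 * (-∞) = 0`, so that
`F^*(-∞) = -F(0)`. -/
def legendre (F : ℝ≥0 → ℝ≥0∞) (φ : EReal) : EReal :=
  ⨆ s : ℝ≥0, (((s : ℝ) : EReal) * φ - ((F s : ℝ≥0∞) : EReal))

/-- The Kullback-Leibler entropy function `F(s) = s log s - s + 1` (with `F(0) = 1`). -/
def klEntropy (s : ℝ≥0) : ℝ≥0∞ :=
  ENNReal.ofReal ((s : ℝ) * Real.log (s : ℝ) - (s : ℝ) + 1)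

variable {X : Type*} [MeasurableSpace X]

/-- The primal functional
`𝓔(γ ∣ μ₀, μ₁) = 𝓕(γ₀ ∣ μ₀) + 𝓕(γ₁ ∣ μ₁) + ∫ c dγ`, with `γ₀, γ₁` the marginals of `γ`. -/
def primal (c : X × X → EReal) (μ₀ μ₁ : FiniteMeasure X) (γ : FiniteMeasure (X × X)) : EReal :=
  ((entropyFunctional klEntropy ((γ : Measure (X × X)).map Prod.fst) (μ₀ : Measure X) : ℝ≥0∞)
      : EReal)
    + ((entropyFunctional klEntropy ((γ : Measure (X × X)).map Prod.snd) (μ₁ : Measure X) : ℝ≥0∞)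
      : EReal)
    + eintegral (γ : Measure (X × X)) c

/-- The regularised primal functional
`𝓔_ε(γ ∣ μ₀, μ₁, ν) = 𝓔(γ ∣ μ₀, μ₁) + ε 𝓕(γ ∣ ν)`. -/
def primalReg (c : X × X → EReal) (ε : ℝ) (μ₀ μ₁ : FiniteMeasure X)
    (ν γ : FiniteMeasure (X × X)) : EReal :=
  primal c μ₀ μ₁ γ
    + (ε : EReal) * ((entropyFunctional klEntropy (γ : Measure (X × X)) (ν : Measure (X × X))
      : ℝ≥0∞) : EReal)

/-- `UOT_{X,ε}(μ₀, μ₁)`: the infimum of `𝓔_ε` over all finite measures on `X × X`. -/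
def uotReg (c : X × X → EReal) (ε : ℝ) (μ₀ μ₁ : FiniteMeasure X)
    (ν : FiniteMeasure (X × X)) : EReal :=
  ⨅ γ : FiniteMeasure (X × X), primalReg c ε μ₀ μ₁ ν γ

/-- The dual functional
`∑ᵢ μᵢ(-F^*(-φᵢ)) + ε ν(-F^*((φ₀ ⊕ φ₁ - c) / ε))`. -/
def dualReg (c : X × X → EReal) (ε : ℝ) (μ₀ μ₁ : FiniteMeasure X) (ν : FiniteMeasure (X × X))
    (φ₀ φ₁ : X → ℝ) : EReal :=
  eintegral (μ₀ : Measure X) (fun x => -legendre klEntropy ((-φ₀ x : ℝ) : EReal))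
    + eintegral (μ₁ : Measure X) (fun x => -legendre klEntropy ((-φ₁ x : ℝ) : EReal))
    + (ε : EReal) * eintegral (ν : Measure (X × X))
        (fun z => -legendre klEntropy ((((φ₀ z.1 + φ₁ z.2 : ℝ) : EReal) - c z) / (ε : EReal)))

/-- The admissible potentials: pairs of bounded continuous functions `φ₀, φ₁` such that
`-F^*(-φ₀)` and `-F^*(-φ₁)` are again real-valued, bounded and continuous. -/
def admissible (X : Type*) [TopologicalSpace X] : Set ((X →ᵇ ℝ) × (X →ᵇ ℝ)) :=
  {φ | (∃ ψ : X →ᵇ ℝ, ∀ x, -legendre klEntropy ((-φ.1 x : ℝ) : EReal) = ((ψ x : ℝ) : EReal)) ∧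
       (∃ ψ : X →ᵇ ℝ, ∀ x, -legendre klEntropy ((-φ.2 x : ℝ) : EReal) = ((ψ x : ℝ) : EReal))}

end UOT

end

/-!
On the disjoint union of `X`, `X` and `X × X` put the reference measure `M = μ₀ ⊔ μ₁ ⊔ ε K`, where
`K = exp (-c / ε) ν` is the Gibbs measure of the cost. Up to the constant `ε (ν(univ) - K(univ))`,
the primal functional at `γ` is the Kullback-Leibler divergence of `γ₀ ⊔ γ₁ ⊔ ε γ` from `M`, and the
dual functional at `(φ₀, φ₁)` is `∫ (1 - exp v) dM` for `v = -φ₀ ⊔ -φ₁ ⊔ (φ₀ ⊕ φ₁) / ε`. These `v`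
form a linear space `V` of bounded functions, and the finite measures annihilating `V` are exactly
those whose first two parts are the marginals of the third.

It remains to minimize entropy over the measures annihilating `V`. Along a minimizing sequence of
`J(u) = ∫ exp u dM` in `V`, the functions `exp (u / 2)` are Cauchy in `L²(M)`, because
`‖exp (u / 2) - exp (v / 2)‖² = J(u) + J(v) - 2 J((u + v) / 2)`. If `h` is their limit, the first
variation of `J` shows that `h² M` annihilates `V`. Replacing each `u` by the best multiple `t u`,
`0 ≤ t ≤ 1`, ensures `∫ u exp u dM ≤ 0`, so that `exp u M` has entropy at most `∫ (1 - exp u) dM`;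
the bound passes to `h² M` by Fatou's lemma.
-/

noncomputable section

namespace UOT

open InformationTheory ProbabilityTheory Real

open scoped RealInnerProductSpace

lemma cauchySeq_of_tendsto_norm_sq_of_le_inner {E : Type*} [NormedAddCommGroup E]
    [InnerProductSpace ℝ E] {f : ℕ → E} {a : ℝ}
    (hf : Tendsto (fun n => ‖f n‖ ^ 2) atTop (𝓝 a)) (ha : ∀ m n, a ≤ ⟪f m, f n⟫) :
    CauchySeq f := by
  have hlim : Tendsto (fun p : ℕ × ℕ => √(‖f p.1‖ ^ 2 + ‖f p.2‖ ^ 2 - 2 * a)) atTop (𝓝 0) := by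
    rw [← prod_atTop_atTop_eq]
    have h := ((hf.comp tendsto_fst).add (hf.comp tendsto_snd)).sub_const (2 * a)
    simpa [← two_mul] using h.sqrt
  refine cauchySeq_iff_tendsto_dist_atTop_0.2
    (squeeze_zero (fun _ => dist_nonneg) (fun p => ?_) hlim)
  rw [dist_eq_norm]
  refine le_sqrt_of_sq_le ?_
  rw [norm_sub_sq_real]
  linarith [ha p.1 p.2]

section Entropy

variable {α : Type*} [MeasurableSpace α] {γ μ : Measure α}

lemma memLp_top_of_absolutelyContinuous (h : γ ≪ μ) {f : α → ℝ} (hf : MemLp f ∞ μ) :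
    MemLp f ∞ γ := by
  refine ⟨hf.aestronglyMeasurable.mono_ac h, lt_of_le_of_lt ?_ hf.eLpNorm_lt_top⟩
  simpa only [eLpNorm_exponent_top] using eLpNormEssSup_mono_measure f h

lemma exists_eq_withDensity_of_absolutelyContinuous [IsFiniteMeasure γ] [SigmaFinite μ]
    (h : γ ≪ μ) : ∃ g : α → ℝ≥0, Measurable g ∧ γ = μ.withDensity fun x => g x := by
  refine ⟨fun x => (γ.rnDeriv μ x).toNNReal, (Measure.measurable_rnDeriv γ μ).ennreal_toNNReal, ?_⟩
  rw [withDensity_congr_ae (g := γ.rnDeriv μ), Measure.withDensity_rnDeriv_eq γ μ h]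
  filter_upwards [Measure.rnDeriv_ne_top γ μ] with x hx
  exact ENNReal.coe_toNNReal hx

lemma klDiv_withDensity [IsFiniteMeasure μ] {g : α → ℝ≥0} (hg : Measurable g)
    [IsFiniteMeasure (μ.withDensity fun x => g x)] :
    klDiv (μ.withDensity fun x => g x) μ = ∫⁻ x, ENNReal.ofReal (klFun (g x)) ∂μ := by
  rw [klDiv_eq_lintegral_klFun_of_ac (withDensity_absolutelyContinuous _ _)]
  refine lintegral_congr_ae ?_
  filter_upwards [Measure.rnDeriv_withDensity μ hg.coe_nnreal_ennreal] with x hx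
  rw [hx, ENNReal.coe_toReal]

end Entropy

section SquareDensity

variable {Ω : Type*} [MeasurableSpace Ω] {M : Measure Ω}

/-- The finite measure with density `f²` with respect to `M`, for `f` in `L²(M)`. -/
def sqMeasure (f : Lp ℝ 2 M) : Measure Ω :=
  M.withDensity fun x => (‖f x‖₊ ^ 2 : ℝ≥0)

lemma measurable_nnnorm_sq (f : Lp ℝ 2 M) : Measurable fun x => ‖f x‖₊ ^ 2 :=
  (Lp.stronglyMeasurable f).measurable.nnnorm.pow_const 2

instance (f : Lp ℝ 2 M) : IsFiniteMeasure (sqMeasure f) := by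
  refine isFiniteMeasure_withDensity ?_
  have h := lintegral_rpow_enorm_lt_top_of_eLpNorm_lt_top two_ne_zero ENNReal.ofNat_ne_top
    (Lp.eLpNorm_lt_top f)
  simpa [enorm_eq_nnnorm] using h.ne

lemma integral_sqMeasure (f : Lp ℝ 2 M) (w : Ω → ℝ) :
    ∫ x, w x ∂(sqMeasure f) = ∫ x, w x * f x ^ 2 ∂M := by
  rw [sqMeasure, integral_withDensity_eq_integral_smul (measurable_nnnorm_sq f)]
  simp [NNReal.smul_def, mul_comm]

lemma continuous_integral_sqMeasure {w : Ω → ℝ} (hw : MemLp w ∞ M) :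
    Continuous fun f : Lp ℝ 2 M => ∫ x, w x ∂(sqMeasure f) := by
  let B := ContinuousLinearMap.mul ℝ ℝ
  have h (f : Lp ℝ 2 M) :
      ∫ x, w x ∂(sqMeasure f) = B.lpPairing M 2 2 (B.holderL M ∞ 2 2 hw.toLp f) f := by
    rw [integral_sqMeasure, B.lpPairing_eq_integral]
    refine integral_congr_ae ?_
    filter_upwards [B.coeFn_holder (r := 2) hw.toLp f, hw.coeFn_toLp] with x hx hwx
    simp only [ContinuousLinearMap.holderL_apply_apply, hx, hwx]
    simp [B, sq, mul_assoc]
  simp only [h]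
  fun_prop

lemma klDiv_sqMeasure [IsFiniteMeasure M] (f : Lp ℝ 2 M) :
    klDiv (sqMeasure f) M = ∫⁻ x, ENNReal.ofReal (klFun (f x ^ 2)) ∂M := by
  have : IsFiniteMeasure (M.withDensity fun x => ((‖f x‖₊ ^ 2 : ℝ≥0) : ℝ≥0∞)) :=
    inferInstanceAs (IsFiniteMeasure (sqMeasure f))
  rw [sqMeasure, klDiv_withDensity (measurable_nnnorm_sq f)]
  simp

lemma klDiv_sqMeasure_le_of_tendsto [IsFiniteMeasure M] {f : ℕ → Lp ℝ 2 M} {h : Lp ℝ 2 M}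
    (hf : Tendsto f atTop (𝓝 h)) {B : ℝ≥0∞} (hB : ∀ n, klDiv (sqMeasure (f n)) M ≤ B) :
    klDiv (sqMeasure h) M ≤ B := by
  obtain ⟨k, -, hk⟩ := (tendstoInMeasure_of_tendsto_Lp hf).exists_seq_tendsto_ae
  have hpoint : ∀ᵐ x ∂M, ENNReal.ofReal (klFun (h x ^ 2))
      = liminf (fun n => ENNReal.ofReal (klFun (f (k n) x ^ 2))) atTop := by
    filter_upwards [hk] with x hx
    have hcont : Continuous fun y : ℝ => ENNReal.ofReal (klFun (y ^ 2)) :=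
      ENNReal.continuous_ofReal.comp (continuous_klFun.comp (continuous_pow 2))
    exact ((hcont.tendsto _).comp hx).liminf_eq.symm
  have hmeas (n : ℕ) : Measurable fun x => ENNReal.ofReal (klFun (f (k n) x ^ 2)) := by
    have := (Lp.stronglyMeasurable (f (k n))).measurable
    fun_prop
  calc klDiv (sqMeasure h) M
      = ∫⁻ x, liminf (fun n => ENNReal.ofReal (klFun (f (k n) x ^ 2))) atTop ∂M := by
        rw [klDiv_sqMeasure, lintegral_congr_ae hpoint]
    _ ≤ liminf (fun n => klDiv (sqMeasure (f (k n))) M) atTop := by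
        simp only [klDiv_sqMeasure]
        exact lintegral_liminf_le hmeas
    _ ≤ B := liminf_le_of_le (by isBoundedDefault) fun b hb =>
        let ⟨n, hn⟩ := hb.exists
        hn.trans (hB (k n))

end SquareDensity

section BoundedExponential

variable {Ω : Type*} [MeasurableSpace Ω] {M : Measure Ω} {u v : Ω → ℝ}

lemma memLp_top_exp (hu : MemLp u ∞ M) : MemLp (fun x => exp (u x)) ∞ M := by
  refine memLp_top_of_bound (continuous_exp.comp_aestronglyMeasurable hu.aestronglyMeasurable)
    (exp (eLpNorm u ∞ M).toReal) ?_
  rw [eLpNorm_exponent_top]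
  filter_upwards [ae_le_eLpNormEssSup (f := u) (μ := M)] with x hx
  have hx' := ENNReal.toReal_mono (by simpa using hu.eLpNorm_ne_top) hx
  rw [norm_eq_abs, abs_exp, exp_le_exp]
  exact (le_abs_self _).trans (by simpa using hx')

variable [IsFiniteMeasure M]

lemma integrable_of_memLp_top (hu : MemLp u ∞ M) : Integrable u M :=
  hu.integrable le_top

lemma integrable_one_sub_exp_of_memLp_top (hu : MemLp u ∞ M) :
    Integrable (fun x => 1 - exp (u x)) M :=
  (integrable_const 1).sub (integrable_of_memLp_top (memLp_top_exp hu))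

lemma integrable_mul_exp_of_memLp_top (hv : MemLp v ∞ M) (hu : MemLp u ∞ M) :
    Integrable (fun x => v x * exp (u x)) M :=
  ((memLp_top_exp hu).mul hv).integrable le_top

lemma integrableExpSet_eq_univ (hu : MemLp u ∞ M) : integrableExpSet u M = Set.univ :=
  Set.eq_univ_of_forall fun t => (memLp_top_exp (hu.const_mul t)).integrable le_top

lemma exists_integral_exp_mul_le_and_integral_mul_exp_nonpos (hu : MemLp u ∞ M) : ∃ t : ℝ,
    ∫ x, exp (t * u x) ∂M ≤ ∫ x, exp (u x) ∂M ∧ ∫ x, (t * u x) * exp (t * u x) ∂M ≤ 0 := by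
  have hderiv (t : ℝ) : HasDerivAt (mgf u M) (∫ x, u x * exp (t * u x) ∂M) t :=
    hasDerivAt_mgf (by simp [integrableExpSet_eq_univ hu])
  obtain ⟨t, ht, hmin⟩ := isCompact_Icc.exists_isMinOn (Set.nonempty_Icc.2 zero_le_one)
    (fun t _ => (hderiv t).continuousAt.continuousWithinAt : ContinuousOn (mgf u M) (Set.Icc 0 1))
  refine ⟨t, by simpa [mgf] using hmin (Set.right_mem_Icc.2 zero_le_one), ?_⟩
  have hseg : segment ℝ t 0 ⊆ Set.Icc 0 1 :=
    (convex_Icc 0 1).segment_subset ht (Set.left_mem_Icc.2 zero_le_one)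
  have h := hmin.localize.hasFDerivWithinAt_nonneg (hderiv t).hasFDerivAt.hasFDerivWithinAt
    (sub_mem_posTangentConeAt_of_segment_subset hseg)
  simp only [mul_assoc, integral_const_mul]
  simpa using h

/-- The element `exp (u / 2)` of `L²(M)`, for `u` bounded: the square root of the density
`exp u`. -/
def expHalf (hu : MemLp u ∞ M) : Lp ℝ 2 M :=
  ((memLp_top_exp (hu.const_mul 2⁻¹)).mono_exponent le_top).toLp

lemma coeFn_expHalf (hu : MemLp u ∞ M) : expHalf hu =ᵐ[M] fun x => exp (2⁻¹ * u x) :=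
  MemLp.coeFn_toLp _

lemma inner_expHalf (hu : MemLp u ∞ M) (hv : MemLp v ∞ M) :
    ⟪expHalf hu, expHalf hv⟫ = ∫ x, exp (2⁻¹ * (u x + v x)) ∂M := by
  rw [L2.inner_def]
  refine integral_congr_ae ?_
  filter_upwards [coeFn_expHalf hu, coeFn_expHalf hv] with x hux hvx
  rw [hux, hvx, RCLike.inner_apply, conj_trivial, ← exp_add, ← mul_add, add_comm]

lemma norm_sq_expHalf (hu : MemLp u ∞ M) : ‖expHalf hu‖ ^ 2 = ∫ x, exp (u x) ∂M := by
  rw [← real_inner_self_eq_norm_sq, inner_expHalf]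
  simp only [← two_mul, inv_mul_cancel_left₀ (two_ne_zero' ℝ)]

lemma sq_expHalf_ae_eq (hu : MemLp u ∞ M) :
    (fun x => expHalf hu x ^ 2) =ᵐ[M] fun x => exp (u x) := by
  filter_upwards [coeFn_expHalf hu] with x hx
  rw [hx, ← exp_nat_mul]
  congr 1
  push_cast
  ring

lemma integral_sqMeasure_expHalf (hu : MemLp u ∞ M) (w : Ω → ℝ) :
    ∫ x, w x ∂(sqMeasure (expHalf hu)) = ∫ x, w x * exp (u x) ∂M := by
  rw [integral_sqMeasure]
  refine integral_congr_ae ?_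
  filter_upwards [sq_expHalf_ae_eq hu] with x hx
  rw [hx]

lemma klFun_exp_mul (x s : ℝ) :
    klFun (exp x * s) = exp x * klFun s + x * exp x * s + (1 - exp x) := by
  rcases eq_or_ne s 0 with rfl | hs
  · simp [klFun_zero]
  · rw [klFun_apply, klFun_apply, log_mul (exp_ne_zero x) hs, log_exp]
    ring

lemma klFun_exp (x : ℝ) : klFun (exp x) = x * exp x + (1 - exp x) := by
  simpa [klFun_one] using klFun_exp_mul x 1

lemma klDiv_sqMeasure_expHalf (hu : MemLp u ∞ M) :
    klDiv (sqMeasure (expHalf hu)) M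
      = ENNReal.ofReal (∫ x, u x * exp (u x) ∂M + ∫ x, (1 - exp (u x)) ∂M) := by
  have h₁ := integrable_mul_exp_of_memLp_top hu hu
  have h₂ := integrable_one_sub_exp_of_memLp_top hu
  rw [klDiv_sqMeasure, ← integral_add h₁ h₂, ofReal_integral_eq_lintegral_ofReal (h₁.fun_add h₂)]
  · refine lintegral_congr_ae ?_
    filter_upwards [sq_expHalf_ae_eq hu] with x hx
    rw [hx, klFun_exp]
  · exact ae_of_all _ fun x => by simpa [klFun_exp] using klFun_nonneg (exp_pos (u x)).le

lemma mul_le_klFun_add_exp {s : ℝ} (hs : 0 ≤ s) (x : ℝ) : s * x ≤ klFun s + (exp x - 1) := by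
  rcases hs.eq_or_lt with rfl | hs
  · simpa [klFun_zero] using (exp_pos x).le
  · have h := add_one_le_exp (x - log s)
    rw [exp_sub, exp_log hs, le_div_iff₀ hs] at h
    rw [klFun_apply]
    linarith

theorem ofReal_integral_add_integral_one_sub_exp_le_klDiv {N : Measure Ω} [IsFiniteMeasure N]
    (hv : MemLp v ∞ M) :
    ENNReal.ofReal (∫ x, v x ∂N + ∫ x, (1 - exp (v x)) ∂M) ≤ klDiv N M := by
  by_cases htop : klDiv N M = ∞
  · exact htop ▸ le_top
  obtain ⟨hac, hllr⟩ := klDiv_ne_top_iff.1 htop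
  have hexp : Integrable (fun x => exp (v x) - 1) M :=
    (integrable_of_memLp_top (memLp_top_exp hv)).sub (integrable_const 1)
  have hklFun := (integrable_klFun_rnDeriv_iff hac).2 hllr
  have hvN := integrable_of_memLp_top (memLp_top_of_absolutelyContinuous hac hv)
  refine ENNReal.ofReal_le_of_le_toReal ?_
  calc ∫ x, v x ∂N + ∫ x, (1 - exp (v x)) ∂M
      = ∫ x, (N.rnDeriv M x).toReal * v x ∂M - ∫ x, (exp (v x) - 1) ∂M := by
        rw [← integral_rnDeriv_smul hac, sub_eq_add_neg, ← integral_neg]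
        simp only [smul_eq_mul, neg_sub]
    _ ≤ ∫ x, klFun (N.rnDeriv M x).toReal ∂M := by
        rw [sub_le_iff_le_add, ← integral_add hklFun hexp]
        exact integral_mono ((integrable_rnDeriv_smul_iff hac).2 hvN) (hklFun.add hexp)
          fun x => mul_le_klFun_add_exp ENNReal.toReal_nonneg (v x)
    _ = (klDiv N M).toReal := (toReal_klDiv_eq_integral_klFun hac).symm

end BoundedExponential

section Minimization

variable {Ω : Type*} [MeasurableSpace Ω] {M : Measure Ω} {V : Submodule ℝ (Ω → ℝ)}

/-- The infimum of `∫ exp v dM` over the functions `v` of a linear space `V`. -/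
def infIntegralExp (M : Measure Ω) (V : Submodule ℝ (Ω → ℝ)) : ℝ :=
  ⨅ v : V, ∫ x, exp ((v : Ω → ℝ) x) ∂M

lemma infIntegralExp_le {v : Ω → ℝ} (hv : v ∈ V) : infIntegralExp M V ≤ ∫ x, exp (v x) ∂M :=
  ciInf_le (f := fun v : V => ∫ x, exp ((v : Ω → ℝ) x) ∂M)
    ⟨0, by rintro _ ⟨v, rfl⟩; exact integral_nonneg fun x => (exp_pos _).le⟩ ⟨v, hv⟩

variable [IsFiniteMeasure M]

lemma exists_seq_tendsto_infIntegralExp (hV : ∀ v ∈ V, MemLp v ∞ M) :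
    ∃ u : ℕ → V, Tendsto (fun n => ∫ x, exp ((u n : Ω → ℝ) x) ∂M) atTop (𝓝 (infIntegralExp M V)) ∧
      ∀ n, ∫ x, (u n : Ω → ℝ) x * exp ((u n : Ω → ℝ) x) ∂M ≤ 0 := by
  obtain ⟨J, -, hJ, hJmem⟩ := exists_seq_tendsto_sInf
    (Set.range_nonempty fun v : V => ∫ x, exp ((v : Ω → ℝ) x) ∂M)
    ⟨0, by rintro _ ⟨v, rfl⟩; exact integral_nonneg fun x => (exp_pos _).le⟩
  choose w hw using hJmem
  choose t ht using fun n =>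
    exists_integral_exp_mul_le_and_integral_mul_exp_nonpos (hV (w n) (w n).2)
  refine ⟨fun n => t n • w n, ?_, fun n => (ht n).2⟩
  refine tendsto_of_tendsto_of_tendsto_of_le_of_le tendsto_const_nhds hJ
    (fun n => infIntegralExp_le (t n • w n).2) fun n => ?_
  exact (ht n).1.trans_eq (hw n)

theorem exists_annihilating_measure_klDiv_le (hV : ∀ v ∈ V, MemLp v ∞ M) {A : ℝ}
    (hA : ∀ v ∈ V, ∫ x, (1 - exp (v x)) ∂M ≤ A) :
    ∃ N : Measure Ω, IsFiniteMeasure N ∧ (∀ v ∈ V, ∫ x, v x ∂N = 0) ∧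
      klDiv N M ≤ ENNReal.ofReal A := by
  obtain ⟨u, hu, hu_nonpos⟩ := exists_seq_tendsto_infIntegralExp hV
  have huV (n : ℕ) : MemLp (u n : Ω → ℝ) ∞ M := hV (u n) (u n).2
  have hcauchy : CauchySeq fun n => expHalf (huV n) := by
    refine cauchySeq_of_tendsto_norm_sq_of_le_inner (by simpa only [norm_sq_expHalf] using hu)
      fun m n => ?_
    rw [inner_expHalf]
    exact infIntegralExp_le ((2⁻¹ : ℝ) • (u m + u n)).2
  obtain ⟨h, hlim⟩ := cauchySeq_tendsto_of_complete hcauchy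
  have hmgf {v : Ω → ℝ} (hv : v ∈ V) (s : ℝ) :
      Tendsto (fun n => ∫ x, exp (s * v x + (u n : Ω → ℝ) x) ∂M) atTop
        (𝓝 (mgf v (sqMeasure h) s)) := by
    have := ((continuous_integral_sqMeasure (memLp_top_exp ((hV v hv).const_mul s))).tendsto
      h).comp hlim
    simpa only [Function.comp_def, integral_sqMeasure_expHalf, ← exp_add, mgf] using this
  refine ⟨sqMeasure h, inferInstance, fun v hv => ?_,
    klDiv_sqMeasure_le_of_tendsto hlim fun n => ?_⟩
  · have hzero : mgf v (sqMeasure h) 0 = infIntegralExp M V :=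
      tendsto_nhds_unique (by simpa using hmgf hv 0) hu
    have hmin : IsLocalMin (mgf v (sqMeasure h)) 0 := Eventually.of_forall fun s => by
      rw [hzero]
      exact ge_of_tendsto (hmgf hv s)
        (Eventually.of_forall fun n => infIntegralExp_le (s • (⟨v, hv⟩ : V) + u n).2)
    have hv' : MemLp v ∞ (sqMeasure h) :=
      memLp_top_of_absolutelyContinuous (withDensity_absolutelyContinuous _ _) (hV v hv)
    rw [← deriv_mgf_zero (by simp [integrableExpSet_eq_univ hv'])]
    exact hmin.deriv_eq_zero
  · rw [klDiv_sqMeasure_expHalf]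
    exact ENNReal.ofReal_le_ofReal (by linarith [hu_nonpos n, hA (u n) (u n).2])

end Minimization

section SumMeasure

variable {α β : Type*} [MeasurableSpace α] [MeasurableSpace β]

lemma measurableEmbedding_inl : MeasurableEmbedding (Sum.inl : α → α ⊕ β) :=
  ⟨Sum.inl_injective, measurable_inl, fun _ => measurableSet_inl_image.2⟩

lemma measurableEmbedding_inr : MeasurableEmbedding (Sum.inr : β → α ⊕ β) :=
  ⟨Sum.inr_injective, measurable_inr, fun _ => measurableSet_inr_image.2⟩

/-- The measure on the disjoint union `α ⊕ β` that restricts to `μ` on `α` and to `ν` on `β`. -/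
def sumMeasure (μ : Measure α) (ν : Measure β) : Measure (α ⊕ β) :=
  μ.map Sum.inl + ν.map Sum.inr

variable {γ μ : Measure α} {γ' ν : Measure β}

lemma sumMeasure_apply (s : Set (α ⊕ β)) :
    sumMeasure μ ν s = μ (Sum.inl ⁻¹' s) + ν (Sum.inr ⁻¹' s) := by
  rw [sumMeasure, Measure.add_apply, measurableEmbedding_inl.map_apply,
    measurableEmbedding_inr.map_apply]

instance [IsFiniteMeasure μ] [IsFiniteMeasure ν] : IsFiniteMeasure (sumMeasure μ ν) := by
  unfold sumMeasure
  infer_instance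

lemma lintegral_sumMeasure (f : α ⊕ β → ℝ≥0∞) :
    ∫⁻ z, f z ∂(sumMeasure μ ν) = ∫⁻ x, f (.inl x) ∂μ + ∫⁻ y, f (.inr y) ∂ν := by
  rw [sumMeasure, lintegral_add_measure, measurableEmbedding_inl.lintegral_map,
    measurableEmbedding_inr.lintegral_map]

lemma integrable_sumMeasure_iff {f : α ⊕ β → ℝ} :
    Integrable f (sumMeasure μ ν) ↔
      Integrable (fun x => f (.inl x)) μ ∧ Integrable (fun y => f (.inr y)) ν := by
  rw [sumMeasure, integrable_add_measure, measurableEmbedding_inl.integrable_map_iff,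
    measurableEmbedding_inr.integrable_map_iff]
  rfl

lemma integral_sumMeasure {f : α ⊕ β → ℝ} (hf : Integrable f (sumMeasure μ ν)) :
    ∫ z, f z ∂(sumMeasure μ ν) = ∫ x, f (.inl x) ∂μ + ∫ y, f (.inr y) ∂ν := by
  rw [sumMeasure, integrable_add_measure] at hf
  rw [sumMeasure, integral_add_measure hf.1 hf.2, measurableEmbedding_inl.integral_map,
    measurableEmbedding_inr.integral_map]

lemma sumMeasure_comap_comap (N : Measure (α ⊕ β)) :
    sumMeasure (N.comap Sum.inl) (N.comap Sum.inr) = N := by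
  rw [sumMeasure, measurableEmbedding_inl.map_comap, measurableEmbedding_inr.map_comap,
    ← Set.isCompl_range_inl_range_inr.compl_eq,
    Measure.restrict_add_restrict_compl measurableSet_range_inl]

lemma absolutelyContinuous_sumMeasure_iff :
    sumMeasure γ γ' ≪ sumMeasure μ ν ↔ γ ≪ μ ∧ γ' ≪ ν := by
  refine ⟨fun h => ⟨fun s hs => ?_, fun s hs => ?_⟩, fun h s hs => ?_⟩
  · have := h (s := Sum.inl '' s)
    simp_all [sumMeasure_apply, Set.preimage_image_eq _ Sum.inl_injective]
  · have := h (s := Sum.inr '' s)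
    simp_all [sumMeasure_apply, Set.preimage_image_eq _ Sum.inr_injective]
  · rw [sumMeasure_apply, add_eq_zero] at hs ⊢
    exact ⟨h.1 hs.1, h.2 hs.2⟩

lemma sumMeasure_withDensity {g : α → ℝ≥0∞} (hg : Measurable g) {g' : β → ℝ≥0∞}
    (hg' : Measurable g') :
    sumMeasure (μ.withDensity g) (ν.withDensity g')
      = (sumMeasure μ ν).withDensity (Sum.elim g g') := by
  refine Measure.ext_of_lintegral _ fun f hf => ?_
  rw [lintegral_sumMeasure, lintegral_withDensity_eq_lintegral_mul _ hg (by fun_prop),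
    lintegral_withDensity_eq_lintegral_mul _ hg' (by fun_prop),
    lintegral_withDensity_eq_lintegral_mul _ (hg.sumElim hg') hf, lintegral_sumMeasure]
  rfl

lemma klDiv_sumMeasure [IsFiniteMeasure γ] [IsFiniteMeasure γ'] [IsFiniteMeasure μ]
    [IsFiniteMeasure ν] :
    klDiv (sumMeasure γ γ') (sumMeasure μ ν) = klDiv γ μ + klDiv γ' ν := by
  by_cases h : γ ≪ μ ∧ γ' ≪ ν
  · obtain ⟨g, hg, rfl⟩ := exists_eq_withDensity_of_absolutelyContinuous h.1
    obtain ⟨g', hg', rfl⟩ := exists_eq_withDensity_of_absolutelyContinuous h.2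
    have hsum : sumMeasure (μ.withDensity fun x => g x) (ν.withDensity fun y => g' y)
        = (sumMeasure μ ν).withDensity fun z => (Sum.elim g g' z : ℝ≥0) := by
      rw [sumMeasure_withDensity (by fun_prop) (by fun_prop)]
      congr 1 with (x | y) <;> rfl
    have : IsFiniteMeasure ((sumMeasure μ ν).withDensity fun z => (Sum.elim g g' z : ℝ≥0)) :=
      hsum ▸ inferInstance
    rw [hsum, klDiv_withDensity (hg.sumElim hg'), klDiv_withDensity hg, klDiv_withDensity hg',
      lintegral_sumMeasure]
    rfl
  · rw [klDiv_of_not_ac (absolutelyContinuous_sumMeasure_iff.not.2 h)]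
    rcases not_and_or.1 h with h | h <;> simp [klDiv_of_not_ac h]

end SumMeasure

section Potential

variable {X Y : Type*} [TopologicalSpace X] [TopologicalSpace Y]

/-- The linear map sending a pair `(φ, ψ)` of potentials to the function equal to `-φ` on `X`,
`-ψ` on `Y` and `(φ ⊕ ψ) / ε` on `X × Y`. -/
def potential (ε : ℝ≥0) : (X →ᵇ ℝ) × (Y →ᵇ ℝ) →ₗ[ℝ] (X ⊕ (Y ⊕ X × Y) → ℝ) where
  toFun φ := Sum.elim (fun x => -φ.1 x)
    (Sum.elim (fun y => -φ.2 y) fun z => (φ.1 z.1 + φ.2 z.2) / ε)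
  map_add' φ ψ := by
    ext (x | y | z) <;> simp only [Prod.fst_add, Prod.snd_add, BoundedContinuousFunction.coe_add,
      Pi.add_apply, Sum.elim_inl, Sum.elim_inr] <;> ring
  map_smul' a φ := by
    ext (x | y | z) <;> simp only [Prod.smul_fst, Prod.smul_snd,
      BoundedContinuousFunction.coe_smul, Pi.smul_apply, smul_eq_mul, RingHom.id_apply,
      Sum.elim_inl, Sum.elim_inr] <;> ring

variable {ε : ℝ≥0} (φ : (X →ᵇ ℝ) × (Y →ᵇ ℝ))

lemma potential_inl (x : X) : potential ε φ (.inl x) = -φ.1 x :=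
  rfl

lemma potential_inr_inl (y : Y) : potential ε φ (.inr (.inl y)) = -φ.2 y :=
  rfl

lemma potential_inr_inr (z : X × Y) :
    potential ε φ (.inr (.inr z)) = (φ.1 z.1 + φ.2 z.2) / ε :=
  rfl

end Potential

section Coupling

variable {X Y : Type*} [MeasurableSpace X] [MeasurableSpace Y] {ε : ℝ≥0}

/-- The measure `μ ⊔ ν ⊔ ε γ` on the disjoint union of `X`, `Y` and `X × Y`, which turns a sum of
three entropies, the last one weighted by `ε`, into a single divergence. -/
def unionMeasure (ε : ℝ≥0) (μ : Measure X) (ν : Measure Y) (γ : Measure (X × Y)) :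
    Measure (X ⊕ (Y ⊕ X × Y)) :=
  sumMeasure μ (sumMeasure ν (ε • γ))

variable {μ μ' : Measure X} {ν ν' : Measure Y} {γ γ' : Measure (X × Y)}

instance [IsFiniteMeasure μ] [IsFiniteMeasure ν] [IsFiniteMeasure γ] :
    IsFiniteMeasure (unionMeasure ε μ ν γ) := by
  unfold unionMeasure
  infer_instance

lemma exists_eq_unionMeasure (hε : ε ≠ 0) (N : Measure (X ⊕ (Y ⊕ X × Y))) [IsFiniteMeasure N] :
    ∃ μ ν γ, IsFiniteMeasure μ ∧ IsFiniteMeasure ν ∧ IsFiniteMeasure γ ∧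
      unionMeasure ε μ ν γ = N := by
  refine ⟨N.comap .inl, (N.comap .inr).comap .inl, ε⁻¹ • (N.comap .inr).comap .inr,
    inferInstance, inferInstance, inferInstance, ?_⟩
  rw [unionMeasure, smul_inv_smul₀ hε, sumMeasure_comap_comap, sumMeasure_comap_comap]

lemma klDiv_unionMeasure [IsFiniteMeasure μ] [IsFiniteMeasure μ'] [IsFiniteMeasure ν]
    [IsFiniteMeasure ν'] [IsFiniteMeasure γ] [IsFiniteMeasure γ'] :
    klDiv (unionMeasure ε μ ν γ) (unionMeasure ε μ' ν' γ')
      = klDiv μ μ' + klDiv ν ν' + ε * klDiv γ γ' := by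
  simp only [unionMeasure, klDiv_sumMeasure, klDiv_smul_same, add_assoc]

lemma integrable_unionMeasure (hε : ε ≠ 0) {f : X ⊕ (Y ⊕ X × Y) → ℝ}
    (hf : Integrable f (unionMeasure ε μ ν γ)) :
    Integrable (fun x => f (.inl x)) μ ∧ Integrable (fun y => f (.inr (.inl y))) ν ∧
      Integrable (fun z => f (.inr (.inr z))) γ := by
  obtain ⟨h₁, h⟩ := integrable_sumMeasure_iff.1 hf
  obtain ⟨h₂, h₃⟩ := integrable_sumMeasure_iff.1 h
  exact ⟨h₁, h₂, (integrable_smul_measure (by simpa using hε) ENNReal.coe_ne_top).1 h₃⟩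

lemma integral_unionMeasure {f : X ⊕ (Y ⊕ X × Y) → ℝ}
    (hf : Integrable f (unionMeasure ε μ ν γ)) :
    ∫ ω, f ω ∂(unionMeasure ε μ ν γ) = ∫ x, f (.inl x) ∂μ + ∫ y, f (.inr (.inl y)) ∂ν
      + ε * ∫ z, f (.inr (.inr z)) ∂γ := by
  rw [unionMeasure, integral_sumMeasure hf, integral_sumMeasure (integrable_sumMeasure_iff.1 hf).2,
    integral_smul_nnreal_measure, NNReal.smul_def, smul_eq_mul, add_assoc]

section OpensMeasurable

variable [TopologicalSpace X] [TopologicalSpace Y] [OpensMeasurableSpace X]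
  [OpensMeasurableSpace Y] (φ : (X →ᵇ ℝ) × (Y →ᵇ ℝ))

lemma memLp_top_potential (M : Measure (X ⊕ (Y ⊕ X × Y))) : MemLp (potential ε φ) ∞ M := by
  have h₁ := φ.1.continuous.measurable
  have h₂ := φ.2.continuous.measurable
  have hmeas : Measurable (potential ε φ) := h₁.neg.sumElim (h₂.neg.sumElim (by fun_prop))
  refine memLp_top_of_bound hmeas.aestronglyMeasurable
    (max ‖φ.1‖ (max ‖φ.2‖ ((‖φ.1‖ + ‖φ.2‖) / ε))) (ae_of_all _ ?_)
  rintro (x | y | z)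
  · exact le_max_of_le_left ((norm_neg _).trans_le (φ.1.norm_coe_le_norm x))
  · exact le_max_of_le_right (le_max_of_le_left ((norm_neg _).trans_le (φ.2.norm_coe_le_norm y)))
  · refine le_max_of_le_right (le_max_of_le_right ?_)
    rw [potential_inr_inr, norm_div, NNReal.norm_eq]
    gcongr
    exact norm_add_le_of_le (φ.1.norm_coe_le_norm z.1) (φ.2.norm_coe_le_norm z.2)

lemma integral_potential (hε : ε ≠ 0) [IsFiniteMeasure μ] [IsFiniteMeasure ν] [IsFiniteMeasure γ] :
    ∫ ω, potential ε φ ω ∂(unionMeasure ε μ ν γ)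
      = (∫ x, φ.1 x ∂(γ.map Prod.fst) - ∫ x, φ.1 x ∂μ)
        + (∫ y, φ.2 y ∂(γ.map Prod.snd) - ∫ y, φ.2 y ∂ν) := by
  have h₁ : ∫ x, φ.1 x ∂(γ.map Prod.fst) = ∫ z, φ.1 z.1 ∂γ :=
    integral_map measurable_fst.aemeasurable φ.1.continuous.measurable.aestronglyMeasurable
  have h₂ : ∫ y, φ.2 y ∂(γ.map Prod.snd) = ∫ z, φ.2 z.2 ∂γ :=
    integral_map measurable_snd.aemeasurable φ.2.continuous.measurable.aestronglyMeasurable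
  have hi₁ : Integrable (fun z : X × Y => φ.1 z.1) γ :=
    (φ.1.integrable (γ.map Prod.fst)).comp_measurable measurable_fst
  have hi₂ : Integrable (fun z : X × Y => φ.2 z.2) γ :=
    (φ.2.integrable (γ.map Prod.snd)).comp_measurable measurable_snd
  have hε' : (ε : ℝ) ≠ 0 := NNReal.coe_ne_zero.2 hε
  rw [integral_unionMeasure (integrable_of_memLp_top (memLp_top_potential φ _)), h₁, h₂]
  simp only [potential_inl, potential_inr_inl, potential_inr_inr, integral_neg, integral_div,
    integral_add hi₁ hi₂]
  field_simp
  ring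

theorem ofReal_integral_one_sub_exp_potential_le_klDiv (hε : ε ≠ 0) [IsFiniteMeasure γ]
    {M : Measure (X ⊕ (Y ⊕ X × Y))} [IsFiniteMeasure M] :
    ENNReal.ofReal (∫ ω, (1 - exp (potential ε φ ω)) ∂M)
      ≤ klDiv (unionMeasure ε (γ.map Prod.fst) (γ.map Prod.snd) γ) M := by
  have h := ofReal_integral_add_integral_one_sub_exp_le_klDiv
    (N := unionMeasure ε (γ.map Prod.fst) (γ.map Prod.snd) γ) (memLp_top_potential (ε := ε) φ M)
  rwa [integral_potential φ hε, sub_self, sub_self, add_zero, zero_add] at h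

end OpensMeasurable

variable [TopologicalSpace X] [TopologicalSpace Y] [BorelSpace X] [BorelSpace Y]
  [HasOuterApproxClosed X] [HasOuterApproxClosed Y]

lemma eq_marginals_of_integral_potential_eq_zero (hε : ε ≠ 0) [IsFiniteMeasure μ]
    [IsFiniteMeasure ν] [IsFiniteMeasure γ]
    (h : ∀ φ : (X →ᵇ ℝ) × (Y →ᵇ ℝ), ∫ ω, potential ε φ ω ∂(unionMeasure ε μ ν γ) = 0) :
    μ = γ.map Prod.fst ∧ ν = γ.map Prod.snd := by
  simp only [integral_potential _ hε] at h
  refine ⟨ext_of_forall_integral_eq_of_IsFiniteMeasure fun f => ?_,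
    ext_of_forall_integral_eq_of_IsFiniteMeasure fun f => ?_⟩
  · have : ∫ x, f x ∂(γ.map Prod.fst) - ∫ x, f x ∂μ = 0 := by simpa using h (f, 0)
    exact (sub_eq_zero.1 this).symm
  · have : ∫ y, f y ∂(γ.map Prod.snd) - ∫ y, f y ∂ν = 0 := by simpa using h (0, f)
    exact (sub_eq_zero.1 this).symm

theorem exists_coupling_klDiv_le (hε : ε ≠ 0) {M : Measure (X ⊕ (Y ⊕ X × Y))} [IsFiniteMeasure M]
    {A : ℝ} (hA : ∀ φ : (X →ᵇ ℝ) × (Y →ᵇ ℝ), ∫ ω, (1 - exp (potential ε φ ω)) ∂M ≤ A) :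
    ∃ γ : FiniteMeasure (X × Y), klDiv (unionMeasure ε ((γ : Measure (X × Y)).map Prod.fst)
      ((γ : Measure (X × Y)).map Prod.snd) γ) M ≤ ENNReal.ofReal A := by
  obtain ⟨N, hN, hN_zero, hN_le⟩ := exists_annihilating_measure_klDiv_le
    (V := LinearMap.range (potential ε)) (by rintro _ ⟨φ, rfl⟩; exact memLp_top_potential φ M)
    (by rintro _ ⟨φ, rfl⟩; exact hA φ)
  obtain ⟨μ, ν, γ, hμ, hν, hγ, rfl⟩ := exists_eq_unionMeasure hε N
  obtain ⟨rfl, rfl⟩ := eq_marginals_of_integral_potential_eq_zero hε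
    fun φ => hN_zero _ (LinearMap.mem_range_self _ φ)
  exact ⟨⟨γ, hγ⟩, hN_le⟩

end Coupling

section Cost

variable {ε : ℝ≥0}

/-- The Boltzmann factor `exp (-a / ε)` of an extended real `a ≠ -∞`. It vanishes at `a = ∞`. -/
def boltzmann (ε : ℝ≥0) (a : EReal) : ℝ≥0 :=
  (EReal.exp (((-(ε : ℝ)⁻¹ : ℝ) : EReal) * a)).toNNReal

lemma measurable_boltzmann (ε : ℝ≥0) : Measurable (boltzmann ε) := by
  unfold boltzmann
  fun_prop

lemma boltzmann_coe (ε : ℝ≥0) (x : ℝ) : (boltzmann ε x : ℝ) = exp (-x / ε) := by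
  rw [boltzmann, ← EReal.coe_mul, EReal.exp_coe, ENNReal.coe_toNNReal_eq_toReal,
    ENNReal.toReal_ofReal (exp_pos _).le]
  ring_nf

lemma boltzmann_top (hε : 0 < ε) : boltzmann ε ⊤ = 0 := by
  rw [boltzmann, EReal.coe_mul_top_of_neg (by simpa using hε)]
  simp

lemma boltzmann_ne_zero {a : EReal} (hbot : a ≠ ⊥) (htop : a ≠ ⊤) : boltzmann ε a ≠ 0 := by
  lift a to ℝ using ⟨htop, hbot⟩
  rw [← NNReal.coe_ne_zero, boltzmann_coe]
  exact (exp_pos _).ne'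

lemma boltzmann_le_boltzmann_coe (hε : 0 < ε) {m : ℝ} {a : EReal} (h : (m : EReal) ≤ a) :
    boltzmann ε a ≤ boltzmann ε m := by
  induction a with
  | bot => exact absurd h (EReal.bot_lt_coe m).not_ge
  | top => simp [boltzmann_top hε]
  | coe x =>
    rw [← NNReal.coe_le_coe, boltzmann_coe, boltzmann_coe]
    gcongr
    exact EReal.coe_le_coe_iff.1 h

/-- With `κ = exp (-a / ε)` this is `a κ g + ε F(κ g) = ε κ F(g) + ε (1 - κ)`, both sides moved so
that no subtraction occurs. -/
lemma toENNReal_mul_boltzmann_add_klFun_mul (hε : 0 < ε) {a : EReal} (ha : a ≠ ⊥) (g : ℝ≥0) :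
    boltzmann ε a * g * a.toENNReal
        + ε * ENNReal.ofReal (klFun ((boltzmann ε a * g : ℝ≥0) : ℝ)) + ε * boltzmann ε a
      = ε * (boltzmann ε a * ENNReal.ofReal (klFun g)) + ε
        + boltzmann ε a * g * (-a).toENNReal := by
  induction a with
  | bot => exact absurd rfl ha
  | top => simp [boltzmann_top hε, klFun_zero]
  | coe x =>
    have hkl := klFun_exp_mul (-x / ε) g
    have hε' : (ε : ℝ) ≠ 0 := by positivity
    have hx : max x 0 - max (-x) 0 = x := max_zero_sub_max_neg_zero_eq_self x
    rw [← EReal.coe_neg, EReal.real_coe_toENNReal, EReal.real_coe_toENNReal,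
      ← ENNReal.toReal_eq_toReal_iff' (by finiteness) (by finiteness)]
    simp (disch := finiteness) only [ENNReal.toReal_add, ENNReal.toReal_mul, ENNReal.coe_toReal,
      ENNReal.toReal_ofReal', NNReal.coe_mul, boltzmann_coe]
    rw [max_eq_left (klFun_nonneg (by positivity)), max_eq_left (klFun_nonneg (by positivity)), hkl]
    generalize exp (-x / ε) = κ
    field_simp
    linear_combination κ * g * hx

variable {α : Type*} [MeasurableSpace α] {c : α → EReal} {γ ν : Measure α}

/-- The Gibbs measure `exp (-c / ε) ν` of the cost `c`. -/
def gibbsMeasure (ε : ℝ≥0) (c : α → EReal) (ν : Measure α) : Measure α :=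
  ν.withDensity fun z => boltzmann ε (c z)

lemma isFiniteMeasure_gibbsMeasure [IsFiniteMeasure ν] (hε : 0 < ε) {m : ℝ}
    (hm : ∀ z, (m : EReal) ≤ c z) : IsFiniteMeasure (gibbsMeasure ε c ν) := by
  refine isFiniteMeasure_withDensity (ne_top_of_le_ne_top (b := boltzmann ε m * ν Set.univ)
    (by finiteness) ?_)
  rw [← lintegral_const]
  exact lintegral_mono fun z => ENNReal.coe_le_coe.2 (boltzmann_le_boltzmann_coe hε (hm z))

lemma absolutelyContinuous_gibbsMeasure (hc : Measurable c) (hbot : ∀ z, c z ≠ ⊥) (h : γ ≪ ν)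
    (htop : ∫⁻ z, (c z).toENNReal ∂γ ≠ ∞) : γ ≪ gibbsMeasure ε c ν := by
  intro s hs
  have hae : ∀ᵐ z ∂γ, boltzmann ε (c z) ≠ 0 :=
    (ae_lt_top hc.ereal_toENNReal htop).mono fun z hz =>
      boltzmann_ne_zero (hbot z) (EReal.toENNReal_ne_top_iff.1 hz.ne)
  have hκ : Measurable fun z => boltzmann ε (c z) := (measurable_boltzmann ε).comp hc
  rw [gibbsMeasure, withDensity_apply_eq_zero hκ.coe_nnreal_ennreal] at hs
  refine measure_mono_null_ae ?_ (h hs)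
  filter_upwards [hae] with z hz hzs
  exact ⟨ENNReal.coe_ne_zero.2 hz, hzs⟩

lemma lintegral_cost_add_klDiv [IsFiniteMeasure γ] [IsFiniteMeasure ν]
    [IsFiniteMeasure (gibbsMeasure ε c ν)] (hε : 0 < ε) (hc : Measurable c)
    (hbot : ∀ z, c z ≠ ⊥) :
    ∫⁻ z, (c z).toENNReal ∂γ + ε * klDiv γ ν + ε * gibbsMeasure ε c ν Set.univ
      = ε * klDiv γ (gibbsMeasure ε c ν) + ε * ν Set.univ + ∫⁻ z, (-c z).toENNReal ∂γ := by
  by_cases h : γ ≪ gibbsMeasure ε c ν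
  · obtain ⟨g, hg, rfl⟩ := exists_eq_withDensity_of_absolutelyContinuous h
    have hκ : Measurable fun z => boltzmann ε (c z) := (measurable_boltzmann ε).comp hc
    have hdens : (gibbsMeasure ε c ν).withDensity (fun z => g z)
        = ν.withDensity fun z => (boltzmann ε (c z) * g z : ℝ≥0) := by
      rw [gibbsMeasure, ← withDensity_mul _ (by fun_prop) (by fun_prop)]
      simp only [Pi.mul_def, ENNReal.coe_mul]
    have : IsFiniteMeasure (ν.withDensity fun z => (boltzmann ε (c z) * g z : ℝ≥0)) :=
      hdens ▸ inferInstance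
    have hpos : Measurable fun z => (c z).toENNReal := hc.ereal_toENNReal
    have hneg : Measurable fun z => (-c z).toENNReal := hc.neg.ereal_toENNReal
    rw [klDiv_withDensity hg, hdens, klDiv_withDensity (by fun_prop), gibbsMeasure,
      withDensity_apply _ .univ, Measure.restrict_univ,
      lintegral_withDensity_eq_lintegral_mul _ (by fun_prop) hpos,
      lintegral_withDensity_eq_lintegral_mul _ (by fun_prop) hneg,
      lintegral_withDensity_eq_lintegral_mul _ (by fun_prop) (by fun_prop)]
    simp only [← lintegral_const, ← lintegral_const_mul' _ _ ENNReal.coe_ne_top]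
    rw [← lintegral_add_right _ (by fun_prop), ← lintegral_add_right _ (by fun_prop),
      ← lintegral_add_right _ (by fun_prop), ← lintegral_add_left (by fun_prop)]
    refine lintegral_congr fun z => ?_
    simpa using toENNReal_mul_boltzmann_add_klFun_mul hε (hbot z) (g z)
  · rw [klDiv_of_not_ac h, ENNReal.mul_top (by simpa using hε.ne')]
    suffices ∫⁻ z, (c z).toENNReal ∂γ = ∞ ∨ klDiv γ ν = ∞ by
      rcases this with h | h <;> simp [h, hε.ne']
    by_contra! hne
    exact h (absolutelyContinuous_gibbsMeasure hc hbot (klDiv_ne_top_iff.1 hne.2).1 hne.1)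

lemma coe_sub_add_eq_of_add_add_eq {a b d n k v : ℝ≥0∞} (hn : n ≠ ∞) (hk : k ≠ ∞) (hv : v ≠ ∞)
    (h : a + b + k = d + v + n) :
    (a - n + b : EReal) = d + ((v.toReal - k.toReal : ℝ) : EReal) := by
  lift n to ℝ≥0 using hn
  lift k to ℝ≥0 using hk
  lift v to ℝ≥0 using hv
  have h' : (a + b + ((k : ℝ) : EReal) : EReal) = d + ((v : ℝ) : EReal) + ((n : ℝ) : EReal) := by
    have := congrArg ((↑) : ℝ≥0∞ → EReal) h
    simp only [EReal.coe_ennreal_add] at this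
    exact this
  calc (a - (n : ℝ) + b : EReal)
      = a + b + (k : ℝ) - (k : ℝ) - (n : ℝ) := by
        rw [EReal.add_sub_cancel_right, sub_eq_add_neg, sub_eq_add_neg, add_right_comm]
    _ = d + (v : ℝ) - (k : ℝ) + (n : ℝ) - (n : ℝ) := by
        rw [h', sub_eq_add_neg _ ((k : ℝ) : EReal), sub_eq_add_neg _ ((k : ℝ) : EReal),
          add_right_comm _ ((n : ℝ) : EReal)]
    _ = d + ((v - k : ℝ) : EReal) := by
        rw [EReal.add_sub_cancel_right, EReal.coe_sub, sub_eq_add_neg, sub_eq_add_neg, add_assoc]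

end Cost

section Functionals

variable {α : Type*} [MeasurableSpace α] {γ μ ν : Measure α} {ε : ℝ≥0} {c : α → EReal}

lemma klEntropy_eq_ofReal_klFun (s : ℝ≥0) : klEntropy s = ENNReal.ofReal (klFun s) := by
  rw [klEntropy, klFun_apply, sub_add_eq_add_sub]

lemma recession_klEntropy : recession klEntropy = ∞ := by
  refine Tendsto.limsup_eq ?_
  have hlog : Tendsto (fun s : ℝ≥0 => ENNReal.ofReal (log s - 1)) atTop (𝓝 ∞) :=
    ENNReal.tendsto_ofReal_atTop.comp <| tendsto_atTop_add_const_right _ _ <|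
      tendsto_log_atTop.comp <| NNReal.tendsto_coe_atTop.2 tendsto_id
  refine tendsto_nhds_top_mono hlog ?_
  filter_upwards [eventually_gt_atTop 0] with s hs
  have hs' : (0 : ℝ) < s := hs
  rw [klEntropy_eq_ofReal_klFun, ← ENNReal.ofReal_coe_nnreal, ← ENNReal.ofReal_div_of_pos hs']
  refine ENNReal.ofReal_le_ofReal ?_
  rw [klFun_apply, le_div_iff₀ hs']
  linarith

lemma entropyFunctional_klEntropy [IsFiniteMeasure γ] [IsFiniteMeasure μ] :
    entropyFunctional klEntropy γ μ = klDiv γ μ := by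
  by_cases h : γ ≪ μ
  · rw [entropyFunctional, (Measure.singularPart_eq_zero γ μ).2 h,
      klDiv_eq_lintegral_klFun_of_ac h]
    simp [klEntropy_eq_ofReal_klFun, ENNReal.coe_toNNReal_eq_toReal]
  · rw [klDiv_of_not_ac h, entropyFunctional, recession_klEntropy, ENNReal.top_mul, add_top]
    rwa [Measure.measure_univ_ne_zero, ne_eq, Measure.singularPart_eq_zero]

lemma legendre_klEntropy_coe (x : ℝ) :
    legendre klEntropy (x : EReal) = ((exp x - 1 : ℝ) : EReal) := by
  have hcoe (s : ℝ≥0) : (((s : ℝ) : EReal) * x - ((klEntropy s : ℝ≥0∞) : EReal))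
      = ((s * x - klFun s : ℝ) : EReal) := by
    rw [klEntropy_eq_ofReal_klFun, EReal.coe_ennreal_ofReal,
      max_eq_left (klFun_nonneg s.coe_nonneg), EReal.coe_sub, EReal.coe_mul]
  simp only [legendre, hcoe]
  refine le_antisymm (iSup_le fun s => ?_) ?_
  · exact EReal.coe_le_coe_iff.2 (by linarith [mul_le_klFun_add_exp s.coe_nonneg x])
  · refine le_iSup_of_le (NNReal.mk (exp x) (exp_pos x).le) (EReal.coe_le_coe_iff.2 ?_)
    rw [NNReal.coe_mk, klFun_exp]
    linarith

lemma legendre_klEntropy_bot : legendre klEntropy ⊥ = ((-1 : ℝ) : EReal) := by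
  refine le_antisymm (iSup_le fun s => ?_) (le_iSup_of_le 0 ?_)
  · rcases eq_or_ne s 0 with rfl | hs
    · simp [klEntropy]
    · rw [EReal.coe_mul_bot_of_pos (by exact_mod_cast pos_iff_ne_zero.2 hs), EReal.bot_sub]
      exact bot_le
  · simp [klEntropy]

lemma neg_legendre_klEntropy_coe (x : ℝ) :
    -legendre klEntropy (x : EReal) = ((1 - exp x : ℝ) : EReal) := by
  rw [legendre_klEntropy_coe, ← EReal.coe_neg, neg_sub]

lemma neg_legendre_klEntropy_sub_div (hε : 0 < ε) {a : EReal} (ha : a ≠ ⊥) (x : ℝ) :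
    -legendre klEntropy ((x - a) / ((ε : ℝ) : EReal))
      = ((1 - boltzmann ε a * exp (x / ε) : ℝ) : EReal) := by
  induction a with
  | bot => exact absurd rfl ha
  | top =>
    rw [EReal.sub_top, EReal.bot_div_of_pos_ne_top (by exact_mod_cast hε) (EReal.coe_ne_top _),
      legendre_klEntropy_bot, boltzmann_top hε, ← EReal.coe_neg]
    simp
  | coe y =>
    rw [← EReal.coe_sub, ← EReal.coe_div, neg_legendre_klEntropy_coe, boltzmann_coe, ← exp_add]
    ring_nf

lemma eintegral_coe {f : α → ℝ} (hf : Integrable f μ) :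
    eintegral μ (fun x => (f x : EReal)) = ((∫ x, f x ∂μ : ℝ) : EReal) := by
  have hpos : ∫⁻ x, ENNReal.ofReal (f x) ∂μ ≠ ∞ := hf.lintegral_lt_top.ne
  have hneg : ∫⁻ x, ENNReal.ofReal (-f x) ∂μ ≠ ∞ := hf.neg.lintegral_lt_top.ne
  rw [integral_eq_lintegral_pos_part_sub_lintegral_neg_part hf, EReal.coe_sub,
    EReal.coe_ennreal_toReal hpos, EReal.coe_ennreal_toReal hneg]
  simp only [eintegral, ← EReal.coe_neg, EReal.real_coe_toENNReal]

lemma lintegral_neg_toENNReal_ne_top [IsFiniteMeasure γ] {m : ℝ} (hm : ∀ z, (m : EReal) ≤ c z) :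
    ∫⁻ z, (-c z).toENNReal ∂γ ≠ ∞ := by
  refine ne_top_of_le_ne_top (b := ENNReal.ofReal (-m) * γ Set.univ) (by finiteness) ?_
  rw [← lintegral_const]
  refine lintegral_mono fun z => ?_
  rw [← EReal.real_coe_toENNReal, EReal.coe_neg]
  exact EReal.toENNReal_le_toENNReal (EReal.neg_le_neg_iff.2 (hm z))

lemma ne_bot_of_coe_le {m : ℝ} {a : EReal} (h : (m : EReal) ≤ a) : a ≠ ⊥ :=
  ((EReal.bot_lt_coe m).trans_le h).ne'

/-- The constant `ε (ν(univ) - K(univ))`, where `K` is the Gibbs measure of `c`, by which the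
entropic problem for the cost `c` differs from the entropy minimization problem relative to `K`. -/
def gibbsOffset (ε : ℝ≥0) (c : α → EReal) (ν : Measure α) : ℝ :=
  ε * (ν.real Set.univ - (gibbsMeasure ε c ν).real Set.univ)

lemma eintegral_add_klDiv [IsFiniteMeasure γ] [IsFiniteMeasure ν] (hε : 0 < ε)
    (hc : Measurable c) {m : ℝ} (hm : ∀ z, (m : EReal) ≤ c z) :
    eintegral γ c + ((ε * klDiv γ ν : ℝ≥0∞) : EReal)
      = ((ε * klDiv γ (gibbsMeasure ε c ν) : ℝ≥0∞) : EReal) + (gibbsOffset ε c ν : EReal) := by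
  have := isFiniteMeasure_gibbsMeasure (ν := ν) hε hm
  have h := lintegral_cost_add_klDiv (γ := γ) (ν := ν) hε hc fun z => ne_bot_of_coe_le (hm z)
  rw [eintegral, coe_sub_add_eq_of_add_add_eq (lintegral_neg_toENNReal_ne_top hm) (by finiteness)
    (by finiteness) h, gibbsOffset, mul_sub]
  simp only [ENNReal.toReal_mul, ENNReal.coe_toReal, measureReal_def]

end Functionals

section Duality

lemma mem_admissible {X : Type*} [TopologicalSpace X] (φ : (X →ᵇ ℝ) × (X →ᵇ ℝ)) :
    φ ∈ admissible X := by
  have h (f : X →ᵇ ℝ) : ∃ ψ : X →ᵇ ℝ, ∀ x,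
      -legendre klEntropy ((-f x : ℝ) : EReal) = ((ψ x : ℝ) : EReal) := by
    refine ⟨BoundedContinuousFunction.ofNormedAddCommGroup (fun x => 1 - exp (-f x))
      (by fun_prop) (1 + exp ‖f‖) fun x => ?_, fun x => neg_legendre_klEntropy_coe _⟩
    refine norm_sub_le_of_le (by simp) ?_
    rw [norm_eq_abs, abs_exp, exp_le_exp]
    exact (neg_le_abs _).trans (f.norm_coe_le_norm x)
  exact ⟨h φ.1, h φ.2⟩

variable {X : Type*} [MeasurableSpace X] {c : X × X → EReal} {ε : ℝ≥0}

lemma primalReg_eq_klDiv_add (hε : 0 < ε) (hc : Measurable c) {m : ℝ}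
    (hm : ∀ z, (m : EReal) ≤ c z) (μ₀ μ₁ : FiniteMeasure X) (ν γ : FiniteMeasure (X × X)) :
    primalReg c ε μ₀ μ₁ ν γ
      = (klDiv (unionMeasure ε ((γ : Measure (X × X)).map Prod.fst)
            ((γ : Measure (X × X)).map Prod.snd) γ)
          (unionMeasure ε (μ₀ : Measure X) (μ₁ : Measure X) (gibbsMeasure ε c ν)) : ℝ≥0∞)
        + (gibbsOffset ε c ν : EReal) := by
  have := isFiniteMeasure_gibbsMeasure (ν := (ν : Measure (X × X))) hε hm
  have h := eintegral_add_klDiv (γ := γ) (ν := ν) hε hc hm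
  simp only [primalReg, primal, entropyFunctional_klEntropy, klDiv_unionMeasure,
    EReal.coe_ennreal_add]
  rw [add_assoc _ _ (gibbsOffset ε c _ : EReal), ← h, EReal.coe_ennreal_mul, add_assoc _ _ (_ * _)]
  rfl

lemma integral_one_sub_boltzmann_mul {α : Type*} [MeasurableSpace α] {c : α → EReal}
    {ν : Measure α} [IsFiniteMeasure ν] [IsFiniteMeasure (gibbsMeasure ε c ν)] (hc : Measurable c)
    {w : α → ℝ} (hw : Integrable w (gibbsMeasure ε c ν)) :
    Integrable (fun z => 1 - boltzmann ε (c z) * w z) ν ∧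
      ε * ∫ z, (1 - boltzmann ε (c z) * w z) ∂ν
        = ε * ∫ z, (1 - w z) ∂(gibbsMeasure ε c ν) + gibbsOffset ε c ν := by
  have hκ : Measurable fun z => boltzmann ε (c z) := (measurable_boltzmann ε).comp hc
  have hw' : Integrable (fun z => boltzmann ε (c z) * w z) ν := by
    simpa only [NNReal.smul_def, smul_eq_mul] using
      (integrable_withDensity_iff_integrable_smul hκ).1 hw
  have hgibbs : ∫ z, w z ∂(gibbsMeasure ε c ν) = ∫ z, boltzmann ε (c z) * w z ∂ν := by
    rw [gibbsMeasure, integral_withDensity_eq_integral_smul hκ]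
    simp only [NNReal.smul_def, smul_eq_mul]
  refine ⟨(integrable_const 1).sub hw', ?_⟩
  rw [integral_sub (integrable_const 1) hw', integral_sub (integrable_const 1) hw, hgibbs,
    integral_const, integral_const, gibbsOffset]
  simp only [smul_eq_mul]
  ring

lemma dualReg_eq_integral_add [TopologicalSpace X] [OpensMeasurableSpace X] (hε : 0 < ε)
    (hc : Measurable c) {m : ℝ} (hm : ∀ z, (m : EReal) ≤ c z) (μ₀ μ₁ : FiniteMeasure X)
    (ν : FiniteMeasure (X × X)) (φ : (X →ᵇ ℝ) × (X →ᵇ ℝ)) :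
    dualReg c ε μ₀ μ₁ ν φ.1 φ.2
      = (∫ ω, (1 - exp (potential ε φ ω))
          ∂(unionMeasure ε (μ₀ : Measure X) (μ₁ : Measure X) (gibbsMeasure ε c ν)) : ℝ)
        + (gibbsOffset ε c ν : EReal) := by
  have := isFiniteMeasure_gibbsMeasure (ν := (ν : Measure (X × X))) hε hm
  have hV := memLp_top_potential (ε := ε) φ
    (unionMeasure ε (μ₀ : Measure X) (μ₁ : Measure X) (gibbsMeasure ε c ν))
  have hone := integrable_one_sub_exp_of_memLp_top hV
  obtain ⟨h₀, h₁, -⟩ := integrable_unionMeasure hε.ne' hone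
  obtain ⟨-, -, hexp⟩ :=
    integrable_unionMeasure hε.ne' (integrable_of_memLp_top (memLp_top_exp hV))
  obtain ⟨h₂, hoffset⟩ := integral_one_sub_boltzmann_mul hc hexp
  have hcost (z : X × X) := neg_legendre_klEntropy_sub_div hε (ne_bot_of_coe_le (hm z))
  rw [integral_unionMeasure hone, ← EReal.coe_add, add_assoc _ (_ * _),
    ← hoffset, EReal.coe_add, EReal.coe_add, EReal.coe_mul]
  simp only [potential_inl, potential_inr_inl, potential_inr_inr] at h₀ h₁ h₂ ⊢
  simp only [dualReg, neg_legendre_klEntropy_coe, hcost]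
  rw [eintegral_coe h₀, eintegral_coe h₁, eintegral_coe h₂]

lemma uotReg_le_iSup_dualReg [TopologicalSpace X] [HasOuterApproxClosed X] [BorelSpace X]
    (hε : 0 < ε) (hc : Measurable c) {m : ℝ} (hm : ∀ z, (m : EReal) ≤ c z)
    (μ₀ μ₁ : FiniteMeasure X) (ν : FiniteMeasure (X × X)) :
    uotReg c ε μ₀ μ₁ ν ≤ ⨆ φ ∈ admissible X, dualReg c ε μ₀ μ₁ ν φ.1 φ.2 := by
  have := isFiniteMeasure_gibbsMeasure (ν := (ν : Measure (X × X))) hε hm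
  refine (EReal.le_of_forall_lt_iff_le).1 fun S hS => ?_
  have hle (φ : (X →ᵇ ℝ) × (X →ᵇ ℝ)) : ∫ ω, (1 - exp (potential ε φ ω))
      ∂(unionMeasure ε (μ₀ : Measure X) (μ₁ : Measure X) (gibbsMeasure ε c ν))
        ≤ S - gibbsOffset ε c ν := by
    have h : dualReg c ε μ₀ μ₁ ν φ.1 φ.2 ≤ S :=
      (le_iSup₂_of_le φ (mem_admissible φ) le_rfl).trans hS.le
    rw [dualReg_eq_integral_add hε hc hm, ← EReal.coe_add, EReal.coe_le_coe_iff] at h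
    linarith
  have hnonneg : 0 ≤ S - gibbsOffset ε c ν := by simpa using hle 0
  obtain ⟨γ, hkl⟩ := exists_coupling_klDiv_le hε.ne' hle
  calc uotReg c ε μ₀ μ₁ ν ≤ primalReg c ε μ₀ μ₁ ν γ := iInf_le _ _
    _ ≤ ((S - gibbsOffset ε c ν : ℝ) : EReal) + gibbsOffset ε c ν := by
      rw [primalReg_eq_klDiv_add hε hc hm, ← max_eq_left hnonneg, ← EReal.coe_ennreal_ofReal]
      gcongr
      exact EReal.coe_ennreal_le_coe_ennreal_iff.2 hkl
    _ = S := by rw [← EReal.coe_add, sub_add_cancel]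

lemma dualReg_le_primalReg [TopologicalSpace X] [OpensMeasurableSpace X]
    (hε : 0 < ε) (hc : Measurable c) {m : ℝ} (hm : ∀ z, (m : EReal) ≤ c z)
    (μ₀ μ₁ : FiniteMeasure X) (ν γ : FiniteMeasure (X × X)) (φ : (X →ᵇ ℝ) × (X →ᵇ ℝ)) :
    dualReg c ε μ₀ μ₁ ν φ.1 φ.2 ≤ primalReg c ε μ₀ μ₁ ν γ := by
  have := isFiniteMeasure_gibbsMeasure (ν := (ν : Measure (X × X))) hε hm
  rw [dualReg_eq_integral_add hε hc hm, primalReg_eq_klDiv_add hε hc hm]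
  gcongr
  refine (EReal.coe_le_coe_iff.2 (le_max_left _ 0)).trans ?_
  rw [← EReal.coe_ennreal_ofReal]
  exact EReal.coe_ennreal_le_coe_ennreal_iff.2
    (ofReal_integral_one_sub_exp_potential_le_klDiv φ hε.ne')

end Duality

end UOT

end

theorem mainTheorem8_general {X : Type*} [TopologicalSpace X] [HasOuterApproxClosed X]
    [MeasurableSpace X] [BorelSpace X] (c : X × X → EReal) (hc : Measurable c)
    (hc_bdd : ∃ m : ℝ, ∀ z, (m : EReal) ≤ c z)
    (μ₀ μ₁ : FiniteMeasure X) (ν : FiniteMeasure (X × X)) (ε : ℝ) (hε : 0 < ε) :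
    UOT.uotReg c ε μ₀ μ₁ ν =
      ⨆ φ ∈ UOT.admissible X, UOT.dualReg c ε μ₀ μ₁ ν φ.1 φ.2 := by
  obtain ⟨m, hm⟩ := hc_bdd
  lift ε to ℝ≥0 using hε.le
  rw [NNReal.coe_pos] at hε
  exact le_antisymm (UOT.uotReg_le_iSup_dualReg hε hc hm μ₀ μ₁ ν)
    (iSup₂_le fun φ _ => le_iInf fun γ =>
      UOT.dualReg_le_primalReg hε hc hm μ₀ μ₁ ν γ φ)

theorem mainTheorem8 {X : Type*} [MetricSpace X] [CompleteSpace X]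
    [TopologicalSpace.SeparableSpace X] [MeasurableSpace X] [BorelSpace X]
    (c : X × X → EReal) (hc : LowerSemicontinuous c)
    (hc_bdd : ∃ m : ℝ, ∀ z, (m : EReal) ≤ c z)
    (μ₀ μ₁ : FiniteMeasure X) (ν : FiniteMeasure (X × X)) (ε : ℝ) (hε : 0 < ε) :
    UOT.uotReg c ε μ₀ μ₁ ν =
      ⨆ φ ∈ UOT.admissible X, UOT.dualReg c ε μ₀ μ₁ ν φ.1 φ.2 := by
  have : SecondCountableTopology X := UniformSpace.secondCountable_of_separable X
  exact mainTheorem8_general c hc.measurable hc_bdd μ₀ μ₁ ν ε hε
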